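/- Let $\Omega\subset\mathbb R^n$ be a bounded domain (open and connected), let $D_u,D_v>0$, and consider $$u_t=D_u\Delta u+f(u,v),\qquad v_t=D_v\Delta v+g(u,v)\qquad\text{in }\Omega,$$ near a homogeneous steady state $(u_0,v_0)$, $f(u_0,v_0)=g(u_0,v_0)=0$, where $f,g:\mathbb R^2\to\mathbb R$ are differentiable at $(u_0,v_0)$, and where the perturbation $(u-u_0,v-v_0)$ satisfies either the homogeneous Dirichlet or the homogeneous Neumann boundary condition on $\partial\Omega$. Let $$A=\begin{pmatrix}a_{11}&a_{12}\\a_{21}&a_{22}\end{pmatrix}=\begin{pmatrix}f_u&f_v\\g_u&g_v\end{pmatrix}(u_0,v_0).$$ Let $H_1$ be the set of complex-valued functions in $H^2(\Omega)$ that satisfy the boundary condition; here Dirichlet means $w\in H^1_0(\Omega)$, and Neumann ($\partial w/\partial n=0$) means $\int_\Omega \Delta w\,\varphi+\int_\Omega\nabla w\cdot\nabla\varphi=0$ for all $\varphi\in H^1(\Omega)$. Eigenvalues of $-\Delta$ are those of $-\Delta:H_1\to L^2(\Omega)$, and the linearization of the system is the operator $$\mathcal L(w,z)=(D_u\Delta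 w+a_{11}w+a_{12}z,\;D_v\Delta z+a_{21}w+a_{22}z),\qquad \mathcal L:H_1\times H_1\to L^2(\Omega)^2 .$$ The system is called *Turing stable* (at $(u_0,v_0)$) if all eigenvalues of $\mathcal L$ have negative real part. It *generates Turing instability* if $(u_0,v_0)$ is linearly stable without diffusion, that is, all eigenvalues of $A$ have negative real part, while $\mathcal L$ has an eigenvalue with positive real part. Assume $\det A>0$ and $\operatorname{Tr}A<0$, and set $$D=D_va_{11}+D_ua_{22},\qquad L=-\frac{\det A}{D_uD_v}+\frac{D^2}{4D_u^2D_v^2}.$$ **Theorem.** (1) If $D\le0$ and $L\le0$, then the system is Turing stable. (2) If $L>0$, then the system generates Turing instability if and only if there is an eigenvalue $\lambda_k$ of $-\Delta$ such that $$\left|\lambda_k-\frac{D}{2D_uD_v}\right|<\sqrt L .$$ -/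

import Mathlib

open MeasureTheory
open scoped ContDiff ENNReal

noncomputable section

namespace TuringSystem

/-- Euclidean space `ℝⁿ`. -/
abbrev Space (n : ℕ) : Type := EuclideanSpace ℝ (Fin n)

/-- The complexified space `L²(Ω)`. -/
abbrev L2 {n : ℕ} (Ω : Set (Space n)) : Type := Lp ℂ 2 (volume.restrict Ω)

/-- The classical partial derivative `∂φ/∂xᵢ`. -/
def partialDeriv {n : ℕ} {F : Type*} [NormedAddCommGroup F] [NormedSpace ℝ F]
    (i : Fin n) (φ : Space n → F) (x : Space n) : F :=
  fderiv ℝ φ x (EuclideanSpace.single i 1)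

/-- Test functions: smooth, with compact support contained in `Ω`. -/
def IsTestFunction {n : ℕ} {F : Type*} [NormedAddCommGroup F] [NormedSpace ℝ F]
    (Ω : Set (Space n)) (φ : Space n → F) : Prop :=
  ContDiff ℝ ∞ φ ∧ HasCompactSupport φ ∧ tsupport φ ⊆ Ω

/-- `g` is the weak partial derivative of `u` on `Ω` in the `i`-th direction. -/
def HasWeakPartial {n : ℕ} {Ω : Set (Space n)} (i : Fin n) (u g : L2 Ω) : Prop :=
  ∀ φ : Space n → ℝ, IsTestFunction Ω φ →
    ∫ x in Ω, partialDeriv i φ x • u x = -∫ x in Ω, φ x • g x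

/-- `u ∈ H¹(Ω)`, with weak gradient `G`. -/
def HasWeakGradient {n : ℕ} {Ω : Set (Space n)} (u : L2 Ω) (G : Fin n → L2 Ω) : Prop :=
  ∀ i, HasWeakPartial i u (G i)

/-- For `u ∈ H¹(Ω)` with weak gradient `G`: `u ∈ H₀¹(Ω)`, the closure of the test functions
in the `H¹` norm. -/
def InH10 {n : ℕ} {Ω : Set (Space n)} (u : L2 Ω) (G : Fin n → L2 Ω) : Prop :=
  ∀ ε : ℝ≥0∞, 0 < ε → ∃ φ : Space n → ℂ, IsTestFunction Ω φ ∧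
    eLpNorm (fun x => φ x - u x) 2 (volume.restrict Ω) < ε ∧
    ∀ i, eLpNorm (fun x => partialDeriv i φ x - G i x) 2 (volume.restrict Ω) < ε

/-- The two homogeneous boundary conditions: zero boundary values, or zero normal derivative. -/
inductive BoundaryCondition
  | dirichlet
  | neumann

/-- The boundary condition for `u ∈ H²(Ω)` with weak gradient `G` and Laplacian `f`.
Dirichlet: `u ∈ H₀¹(Ω)`, that is, `u` has trace zero. Neumann: the boundary term
`∫_{∂Ω} (∂u/∂n) w` in Green's formula, which is `∫_Ω (Δu) w + ∫_Ω ∇u · ∇w`, vanishes for every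
`w ∈ H¹(Ω)`, that is, `∂u/∂n = 0` on `∂Ω`. -/
def BoundaryCondition.Holds {n : ℕ} {Ω : Set (Space n)} (bc : BoundaryCondition)
    (u : L2 Ω) (G : Fin n → L2 Ω) (f : L2 Ω) : Prop :=
  match bc with
  | .dirichlet => InH10 u G
  | .neumann => ∀ (w : L2 Ω) (K : Fin n → L2 Ω), HasWeakGradient w K →
      (∫ x in Ω, f x * w x) + ∑ i, ∫ x in Ω, G i x * K i x = 0

/-- `u ∈ H²(Ω)`, `u` satisfies the boundary condition, and `Δu = f`. -/
def HasLaplacian {n : ℕ} {Ω : Set (Space n)} (bc : BoundaryCondition) (u f : L2 Ω) : Prop :=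
  ∃ (G : Fin n → L2 Ω) (H : Fin n → Fin n → L2 Ω),
    HasWeakGradient u G ∧ (∀ i, HasWeakGradient (G i) (H i)) ∧
    f = ∑ i, H i i ∧ bc.Holds u G f

/-- `l` is an eigenvalue of `-Δ` on `Ω` under the boundary condition `bc`. -/
def IsEigenvalueNegLaplacian {n : ℕ} (Ω : Set (Space n)) (bc : BoundaryCondition) (l : ℝ) :
    Prop :=
  ∃ u Δu : L2 Ω, u ≠ 0 ∧ HasLaplacian bc u Δu ∧ -Δu = (l : ℂ) • u

end TuringSystem

open TuringSystem

/-- The system `u_t = D_u Δu + f(u,v)`, `v_t = D_v Δv + g(u,v)` on a bounded domain `Ω ⊆ ℝⁿ`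
with Dirichlet or Neumann boundary conditions, and a homogeneous steady state `(u₀, v₀)`
(in the Dirichlet case the boundary values are those of the steady state, so that perturbations
of it vanish on the boundary). -/
structure ReactionDiffusionSystem (n : ℕ) where
  Ω : Set (Space n)
  isOpen_Ω : IsOpen Ω
  isConnected_Ω : IsConnected Ω
  isBounded_Ω : Bornology.IsBounded Ω
  bc : BoundaryCondition
  Du : ℝ
  Dv : ℝ
  Du_pos : 0 < Du
  Dv_pos : 0 < Dv
  f : ℝ → ℝ → ℝ
  g : ℝ → ℝ → ℝ
  u₀ : ℝ
  v₀ : ℝ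
  f_steady : f u₀ v₀ = 0
  g_steady : g u₀ v₀ = 0
  differentiableAt_f : DifferentiableAt ℝ (fun p : ℝ × ℝ => f p.1 p.2) (u₀, v₀)
  differentiableAt_g : DifferentiableAt ℝ (fun p : ℝ × ℝ => g p.1 p.2) (u₀, v₀)

namespace ReactionDiffusionSystem

variable {n : ℕ} (S : ReactionDiffusionSystem n)

/-- The Jacobian matrix of the kinetics `(f, g)` at the steady state. -/
def A : Matrix (Fin 2) (Fin 2) ℝ :=
  !![deriv (fun u => S.f u S.v₀) S.u₀, deriv (fun v => S.f S.u₀ v) S.v₀;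
     deriv (fun u => S.g u S.v₀) S.u₀, deriv (fun v => S.g S.u₀ v) S.v₀]

/-- `β` is an eigenvalue of the linearization `(u, v) ↦ (D_u Δu, D_v Δv) + A (u, v)` of the
system at the steady state, acting on pairs of `H²` functions which satisfy the boundary
condition. -/
def IsEigenvalue (β : ℂ) : Prop :=
  ∃ u v Δu Δv : L2 S.Ω, (u ≠ 0 ∨ v ≠ 0) ∧
    HasLaplacian S.bc u Δu ∧ HasLaplacian S.bc v Δv ∧
    (S.Du : ℂ) • Δu + (S.A 0 0 : ℂ) • u + (S.A 0 1 : ℂ) • v = β • u ∧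
    (S.Dv : ℂ) • Δv + (S.A 1 0 : ℂ) • u + (S.A 1 1 : ℂ) • v = β • v

/-- The steady state is (linearly) stable for the system without diffusion
`u' = f(u,v)`, `v' = g(u,v)`: all eigenvalues of the Jacobian have negative real part. -/
def KineticallyStable : Prop :=
  ∀ z : ℂ, Module.End.HasEigenvalue (Matrix.toLin' (S.A.map Complex.ofReal)) z → z.re < 0

/-- Turing stability: all eigenvalues of the linearization of the full system have negative
real part. -/
def TuringStable : Prop :=
  ∀ β : ℂ, S.IsEigenvalue β → β.re < 0

/-- Turing (diffusion-driven) instability: the steady state is stable without diffusion, but the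
linearization of the full system has an eigenvalue with positive real part. -/
def TuringUnstable : Prop :=
  S.KineticallyStable ∧ ∃ β : ℂ, S.IsEigenvalue β ∧ 0 < β.re

end ReactionDiffusionSystem

end

/-! If `(u, v)` is an eigenvector of the linearization for `β`, solving the two equations for `Δu`,
`Δv` shows that `Δ` maps the span of `u` and `v` into itself by a constant matrix. So `Δ` has an
eigenvector in that span (`HasLaplacian.exists_eigenvector`), and no completeness of eigenfunctions
is needed. Hence `β² - T(l) β + d(l) = 0` for an eigenvalue `l` of `-Δ`, where `T`, `d` are
`modeTrace`, `modeDet`. Green's identity gives `l ≥ 0`, so `T(l) < 0`. Conversely, real roots of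
such a quadratic are eigenvalues (`isEigenvalue_of_mode`). As `T(l) < 0`, a root with positive real
part exists exactly when `d(l) < 0`. Completing the square in `d` gives the criterion of (2); for
(1), `D ≤ 0` forces `d(l) ≥ det A > 0`. -/

open MeasureTheory
open scoped ContDiff ENNReal

namespace TuringSystem

variable {n : ℕ} {Ω : Set (Space n)}

/-! ### Test functions -/

section TestFunctions

variable {F : Type*} [NormedAddCommGroup F] [NormedSpace ℝ F] {φ ψ : Space n → F}

theorem IsTestFunction.differentiable (h : IsTestFunction Ω φ) : Differentiable ℝ φ :=
  h.1.differentiable (by simp)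

theorem IsTestFunction.memLp (h : IsTestFunction Ω φ) : MemLp φ 2 (volume.restrict Ω) :=
  h.1.continuous.memLp_of_hasCompactSupport h.2.1

theorem IsTestFunction.memLp_partialDeriv (h : IsTestFunction Ω φ) (i : Fin n) :
    MemLp (partialDeriv i φ) 2 (volume.restrict Ω) :=
  ((h.1.continuous_fderiv (by simp)).clm_apply continuous_const).memLp_of_hasCompactSupport
    (h.2.1.fderiv_apply ℝ _)

theorem isTestFunction_zero : IsTestFunction Ω (0 : Space n → F) :=
  ⟨contDiff_const, HasCompactSupport.zero, by simp [tsupport]⟩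

theorem IsTestFunction.add (h : IsTestFunction Ω φ) (h' : IsTestFunction Ω ψ) :
    IsTestFunction Ω (φ + ψ) :=
  ⟨h.1.add h'.1, h.2.1.add h'.2.1,
    (tsupport_add φ ψ).trans (Set.union_subset h.2.2 h'.2.2)⟩

/-- Test functions are preserved by postcomposition with a continuous linear map. -/
theorem IsTestFunction.clm_comp {E : Type*} [NormedAddCommGroup E] [NormedSpace ℝ E]
    (h : IsTestFunction Ω φ) (T : F →L[ℝ] E) : IsTestFunction Ω (fun x => T (φ x)) :=
  ⟨T.contDiff.comp h.1, h.2.1.comp_left (map_zero T),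
    (tsupport_comp_subset (map_zero T) φ).trans h.2.2⟩

theorem partialDeriv_zero (i : Fin n) : partialDeriv i (0 : Space n → F) = 0 := by
  ext x; simp [partialDeriv]

theorem IsTestFunction.partialDeriv_add (h : IsTestFunction Ω φ) (h' : IsTestFunction Ω ψ)
    (i : Fin n) : partialDeriv i (φ + ψ) = partialDeriv i φ + partialDeriv i ψ := by
  ext x
  simp [partialDeriv, fderiv_add (h.differentiable x) (h'.differentiable x)]

theorem IsTestFunction.partialDeriv_clm_comp {E : Type*} [NormedAddCommGroup E] [NormedSpace ℝ E]
    (h : IsTestFunction Ω φ) (T : F →L[ℝ] E) (i : Fin n) :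
    partialDeriv i (fun x => T (φ x)) = fun x => T (partialDeriv i φ x) := by
  ext x
  have := (T.hasFDerivAt.comp x (h.differentiable x).hasFDerivAt).fderiv
  simp only [partialDeriv]
  rw [show (fun x => T (φ x)) = T ∘ φ from rfl, this]
  rfl

end TestFunctions

/-! ### Weak derivatives as `L²` pairings -/

section WeakDerivatives

theorem integral_smul_eq_inner {φ : Space n → ℝ} {Φ : L2 Ω}
    (hΦ : Φ =ᵐ[volume.restrict Ω] fun x => (φ x : ℂ)) (u : L2 Ω) :
    ∫ x in Ω, φ x • u x = inner ℂ Φ u := by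
  rw [L2.inner_def]
  refine integral_congr_ae ?_
  filter_upwards [hΦ] with x hx
  simp [hx, mul_comm]

/-- With integrals written as inner products, linearity needs no integrability checks. -/
theorem hasWeakPartial_iff {i : Fin n} {u g : L2 Ω} :
    HasWeakPartial i u g ↔ ∀ (φ : Space n → ℝ) (Φ Φ' : L2 Ω), IsTestFunction Ω φ →
      Φ =ᵐ[volume.restrict Ω] (fun x => (φ x : ℂ)) →
      Φ' =ᵐ[volume.restrict Ω] (fun x => ((partialDeriv i φ x : ℝ) : ℂ)) →
      inner ℂ Φ' u = -inner ℂ Φ g := by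
  refine ⟨fun h φ Φ Φ' hφ h1 h2 => ?_, fun h φ hφ => ?_⟩
  · rw [← integral_smul_eq_inner h1, ← integral_smul_eq_inner h2, h φ hφ]
  · have h1 := hφ.memLp.ofReal (K := ℂ)
    have h2 := (hφ.memLp_partialDeriv i).ofReal (K := ℂ)
    rw [integral_smul_eq_inner (φ := φ) h1.coeFn_toLp,
      integral_smul_eq_inner (φ := partialDeriv i φ) h2.coeFn_toLp]
    exact h φ _ _ hφ h1.coeFn_toLp h2.coeFn_toLp

theorem HasWeakPartial.linearCombination {i : Fin n} {u g v k : L2 Ω}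
    (h : HasWeakPartial i u g) (h' : HasWeakPartial i v k) (a b : ℂ) :
    HasWeakPartial i (a • u + b • v) (a • g + b • k) := by
  rw [hasWeakPartial_iff] at *
  intro φ Φ Φ' hφ h1 h2
  simp only [inner_add_right, inner_smul_right, h φ Φ Φ' hφ h1 h2, h' φ Φ Φ' hφ h1 h2]
  ring

theorem coeFn_star_L2 (u : L2 Ω) :
    (star u : L2 Ω) =ᵐ[volume.restrict Ω] fun x => starRingEnd ℂ (u x) :=
  AEEqFun.coeFn_star _

theorem HasWeakPartial.star {i : Fin n} {u g : L2 Ω} (h : HasWeakPartial i u g) :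
    HasWeakPartial i (star u) (star g) := by
  have key : ∀ (r : Space n → ℝ) (w : L2 Ω),
      ∫ x in Ω, r x • (Star.star w : L2 Ω) x = starRingEnd ℂ (∫ x in Ω, r x • w x) := by
    intro r w
    rw [← integral_conj]
    refine integral_congr_ae ?_
    filter_upwards [coeFn_star_L2 w] with x hx
    simp [hx]
  intro φ hφ
  rw [key, key, h φ hφ, map_neg]

theorem integral_mul_star (u v : L2 Ω) :
    ∫ x in Ω, u x * (star v : L2 Ω) x = inner ℂ v u := by
  rw [L2.inner_def]
  refine integral_congr_ae ?_
  filter_upwards [coeFn_star_L2 v] with x hx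
  simp [hx]

theorem integral_mul_eq_inner (u v : L2 Ω) :
    ∫ x in Ω, u x * v x = inner ℂ (star v) u := by
  rw [← integral_mul_star, star_star]

/-- The defining identity of weak derivatives extends to complex test functions. -/
theorem HasWeakPartial.inner_eq {i : Fin n} {u g : L2 Ω} (h : HasWeakPartial i u g)
    {φ : Space n → ℂ} (hφ : IsTestFunction Ω φ) {Φ Φ' : L2 Ω}
    (hΦ : Φ =ᵐ[volume.restrict Ω] φ) (hΦ' : Φ' =ᵐ[volume.restrict Ω] partialDeriv i φ) :
    inner ℂ Φ' u = -inner ℂ Φ g := by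
  rw [hasWeakPartial_iff] at h
  have hre := hφ.clm_comp Complex.reCLM
  have him := hφ.clm_comp Complex.imCLM
  have h1 := hre.memLp.ofReal (K := ℂ)
  have h2 := him.memLp.ofReal (K := ℂ)
  have h3 := (hre.memLp_partialDeriv i).ofReal (K := ℂ)
  have h4 := (him.memLp_partialDeriv i).ofReal (K := ℂ)
  have e1 : Φ = h1.toLp _ + Complex.I • h2.toLp _ := by
    ext1
    filter_upwards [hΦ, Lp.coeFn_add (h1.toLp _) (Complex.I • h2.toLp _),
      Lp.coeFn_smul Complex.I (h2.toLp _), h1.coeFn_toLp, h2.coeFn_toLp] with x a b c d e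
    rw [a, b, Pi.add_apply, c, Pi.smul_apply, d, e]
    simpa [mul_comm] using (Complex.re_add_im (φ x)).symm
  have e2 : Φ' = h3.toLp _ + Complex.I • h4.toLp _ := by
    ext1
    filter_upwards [hΦ', Lp.coeFn_add (h3.toLp _) (Complex.I • h4.toLp _),
      Lp.coeFn_smul Complex.I (h4.toLp _), h3.coeFn_toLp, h4.coeFn_toLp] with x a b c d e
    rw [a, b, Pi.add_apply, c, Pi.smul_apply, d, e, hφ.partialDeriv_clm_comp,
      hφ.partialDeriv_clm_comp]
    simpa [mul_comm] using (Complex.re_add_im (partialDeriv i φ x)).symm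
  rw [e1, e2]
  simp only [inner_add_left, inner_smul_left, h _ _ _ hre h1.coeFn_toLp h3.coeFn_toLp,
    h _ _ _ him h2.coeFn_toLp h4.coeFn_toLp]
  ring

end WeakDerivatives

/-! ### Boundary conditions and Green's identity -/

section BoundaryConditions

/-- Test functions with their gradients, as a subspace of `L² × (L²)ⁿ`. -/
def testGraph (Ω : Set (Space n)) : Submodule ℂ (L2 Ω × (Fin n → L2 Ω)) where
  carrier := {p | ∃ φ : Space n → ℂ, IsTestFunction Ω φ ∧ p.1 =ᵐ[volume.restrict Ω] φ ∧
    ∀ i, p.2 i =ᵐ[volume.restrict Ω] partialDeriv i φ}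
  zero_mem' := ⟨0, isTestFunction_zero, Lp.coeFn_zero _ _ _, fun i => by
    rw [partialDeriv_zero]; exact Lp.coeFn_zero _ _ _⟩
  add_mem' := by
    rintro p q ⟨φ, hφ, h1, h2⟩ ⟨ψ, hψ, h3, h4⟩
    refine ⟨φ + ψ, hφ.add hψ, (Lp.coeFn_add _ _).trans (h1.add h3), fun i => ?_⟩
    rw [hφ.partialDeriv_add hψ]
    exact (Lp.coeFn_add _ _).trans ((h2 i).add (h4 i))
  smul_mem' := by
    rintro c p ⟨φ, hφ, h1, h2⟩
    let T : ℂ →L[ℝ] ℂ := ContinuousLinearMap.mul ℝ ℂ c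
    refine ⟨fun x => T (φ x), hφ.clm_comp T, (Lp.coeFn_smul _ _).trans (h1.const_smul c),
      fun i => ?_⟩
    rw [hφ.partialDeriv_clm_comp]
    exact (Lp.coeFn_smul _ _).trans ((h2 i).const_smul c)

theorem edist_pi_lt_iff {ι : Type*} [Fintype ι] {X : ι → Type*} [∀ i, PseudoEMetricSpace (X i)]
    {f g : ∀ i, X i} {r : ℝ≥0∞} (hr : 0 < r) : edist f g < r ↔ ∀ i, edist (f i) (g i) < r := by
  rw [edist_pi_def, Finset.sup_lt_iff (by simpa using hr)]
  simp

/-- As the closure of a subspace, `H₀¹` is linear, and closed identities extend to it from test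
functions. -/
theorem inH10_iff_mem_topologicalClosure {u : L2 Ω} {G : Fin n → L2 Ω} :
    InH10 u G ↔ (u, G) ∈ (testGraph Ω).topologicalClosure := by
  rw [← SetLike.mem_coe, Submodule.topologicalClosure_coe, EMetric.mem_closure_iff]
  refine forall₂_congr fun ε hε => ⟨?_, ?_⟩
  · rintro ⟨φ, hφ, h1, h2⟩
    refine ⟨(hφ.memLp.toLp φ, fun i => (hφ.memLp_partialDeriv i).toLp _),
      ⟨φ, hφ, hφ.memLp.coeFn_toLp, fun i => (hφ.memLp_partialDeriv i).coeFn_toLp⟩, ?_⟩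
    rw [edist_comm, Prod.edist_eq, max_lt_iff, edist_pi_lt_iff hε]
    refine ⟨?_, fun i => ?_⟩
    · rw [Lp.edist_def]
      exact (eLpNorm_congr_ae (hφ.memLp.coeFn_toLp.sub .rfl)).trans_lt h1
    · rw [Lp.edist_def]
      exact (eLpNorm_congr_ae ((hφ.memLp_partialDeriv i).coeFn_toLp.sub .rfl)).trans_lt (h2 i)
  · rintro ⟨p, ⟨φ, hφ, h1, h2⟩, h⟩
    rw [edist_comm, Prod.edist_eq, max_lt_iff, edist_pi_lt_iff hε] at h
    refine ⟨φ, hφ, ?_, fun i => ?_⟩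
    · have := h.1
      rw [Lp.edist_def] at this
      exact (eLpNorm_congr_ae (h1.symm.sub .rfl)).trans_lt this
    · have := h.2 i
      rw [Lp.edist_def] at this
      exact (eLpNorm_congr_ae ((h2 i).symm.sub .rfl)).trans_lt this

theorem BoundaryCondition.Holds.linearCombination {bc : BoundaryCondition} {u v f g : L2 Ω}
    {G K : Fin n → L2 Ω} (h : bc.Holds u G f) (h' : bc.Holds v K g) (a b : ℂ) :
    bc.Holds (a • u + b • v) (a • G + b • K) (a • f + b • g) := by
  cases bc with
  | dirichlet =>
    simp only [Holds, inH10_iff_mem_topologicalClosure] at *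
    exact add_mem (Submodule.smul_mem _ a h) (Submodule.smul_mem _ b h')
  | neumann =>
    intro w W hw
    have h1 := h w W hw
    have h2 := h' w W hw
    simp only [integral_mul_eq_inner, Pi.add_apply, Pi.smul_apply, inner_add_right,
      inner_smul_right, Finset.sum_add_distrib, ← Finset.mul_sum] at *
    linear_combination a * h1 + b * h2

theorem HasLaplacian.linearCombination {bc : BoundaryCondition} {u v f g : L2 Ω}
    (h : HasLaplacian bc u f) (h' : HasLaplacian bc v g) (a b : ℂ) :
    HasLaplacian bc (a • u + b • v) (a • f + b • g) := by
  obtain ⟨G, H, hG, hH, rfl, hbc⟩ := h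
  obtain ⟨G', H', hG', hH', rfl, hbc'⟩ := h'
  refine ⟨a • G + b • G', a • H + b • H', fun i => (hG i).linearCombination (hG' i) a b,
    fun i j => (hH i j).linearCombination (hH' i j) a b, ?_, hbc.linearCombination hbc' a b⟩
  simp [Finset.sum_add_distrib, Finset.smul_sum]

theorem HasLaplacian.smul {bc : BoundaryCondition} {u f : L2 Ω} (h : HasLaplacian bc u f)
    (a : ℂ) : HasLaplacian bc (a • u) (a • f) := by
  simpa using h.linearCombination h a 0

/-- Green's identity `∫ Δu ū = -∫ |∇u|²` under the boundary condition. -/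
theorem HasLaplacian.exists_inner_eq {bc : BoundaryCondition} {u f : L2 Ω}
    (h : HasLaplacian bc u f) :
    ∃ G : Fin n → L2 Ω, inner ℂ u f = -((∑ i, ‖G i‖ ^ 2 : ℝ) : ℂ) := by
  obtain ⟨G, H, hG, hH, rfl, hbc⟩ := h
  refine ⟨G, ?_⟩
  suffices hs : inner ℂ u (∑ i, H i i) + ∑ i, inner ℂ (G i) (G i) = 0 by
    rw [eq_neg_of_add_eq_zero_left hs]
    push_cast
    exact congrArg Neg.neg (Finset.sum_congr rfl fun i _ => inner_self_eq_norm_sq_to_K (G i))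
  cases bc with
  | dirichlet =>
    have hmem := inH10_iff_mem_topologicalClosure.1 hbc
    -- The identity is continuous in the pair (function, gradient); on test functions it is the
    -- definition of the weak derivative of `G i`.
    have hclosed : IsClosed {p : L2 Ω × (Fin n → L2 Ω) |
        inner ℂ p.1 (∑ i, H i i) + ∑ i, inner ℂ (p.2 i) (G i) = 0} :=
      isClosed_eq (by fun_prop) continuous_const
    refine closure_minimal ?_ hclosed hmem
    rintro p ⟨φ, hφ, h1, h2⟩
    simp only [Set.mem_ofPred_eq, inner_sum, ← Finset.sum_add_distrib]
    refine Finset.sum_eq_zero fun i _ => ?_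
    rw [(hH i i).inner_eq hφ h1 (h2 i), add_neg_cancel]
  | neumann =>
    -- Testing against the conjugate of `u` turns the bilinear pairing into the inner product.
    have := hbc (star u) (fun i => star (G i)) fun i => (hG i).star
    simpa only [integral_mul_star] using this

/-- The eigenvalues of `-Δ` are real and nonnegative. -/
theorem HasLaplacian.exists_eigenvalue {bc : BoundaryCondition} {u : L2 Ω} {μ : ℂ}
    (h : HasLaplacian bc u (μ • u)) (hu : u ≠ 0) :
    ∃ l : ℝ, 0 ≤ l ∧ μ = -(l : ℂ) ∧ IsEigenvalueNegLaplacian Ω bc l := by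
  obtain ⟨G, hG⟩ := h.exists_inner_eq
  have hn : 0 < ‖u‖ ^ 2 := pow_pos (norm_pos_iff.2 hu) 2
  have hμ : μ = -(((∑ i, ‖G i‖ ^ 2) / ‖u‖ ^ 2 : ℝ) : ℂ) := by
    rw [inner_smul_right, inner_self_eq_norm_sq_to_K] at hG
    have hn' : ((‖u‖ : ℂ)) ^ 2 ≠ 0 := by exact_mod_cast hn.ne'
    push_cast at hG ⊢
    rw [← neg_div, eq_div_iff hn']
    exact hG
  refine ⟨(∑ i, ‖G i‖ ^ 2) / ‖u‖ ^ 2,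
    div_nonneg (Finset.sum_nonneg fun i _ => sq_nonneg ‖G i‖) (sq_nonneg ‖u‖), hμ,
    u, μ • u, hu, h, ?_⟩
  rw [← neg_smul]
  exact congrArg (· • u) (neg_eq_iff_eq_neg.2 hμ)

end BoundaryConditions

end TuringSystem

/-! ### Eigenvectors of `Δ` in an invariant span -/

namespace TuringSystem

variable {n : ℕ} {Ω : Set (Space n)}

/-- If `Δ` acts on `(u, v) ≠ 0` by a constant matrix, then some eigenvalue of the matrix is an
eigenvalue of `Δ`. -/
theorem HasLaplacian.exists_eigenvector {bc : BoundaryCondition} {u v : L2 Ω} {a b c d : ℂ}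
    (huv : u ≠ 0 ∨ v ≠ 0) (hu : HasLaplacian bc u (a • u + b • v))
    (hv : HasLaplacian bc v (c • u + d • v)) :
    ∃ (μ : ℂ) (w : L2 Ω), w ≠ 0 ∧ HasLaplacian bc w (μ • w) ∧ (a - μ) * (d - μ) - b * c = 0 := by
  -- The eigenvalues of the matrix `M` are `μ` and `a + d - μ`.
  obtain ⟨δ, hδ⟩ := IsAlgClosed.exists_pow_nat_eq ((a - d) ^ 2 + 4 * (b * c)) (n := 2) two_pos
  obtain ⟨μ, hμ⟩ : ∃ μ, μ = (a + d - δ) / 2 := ⟨_, rfl⟩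
  have h2 : (a - μ) * (d - μ) - b * c = 0 := by
    rw [hμ]; linear_combination hδ / 4
  have h1 : (a - (a + d - μ)) * (d - (a + d - μ)) - b * c = 0 := by
    linear_combination h2
  -- By Cayley–Hamilton, a nonzero entry of `(M - μ)(u, v)` is an eigenvector for the other root. If
  -- both entries vanish, `u` and `v` satisfy `Δw = μ w`.
  by_cases hp : (a - μ) • u + b • v = 0
  · by_cases hq : c • u + (d - μ) • v = 0
    · rcases huv with hu0 | hv0
      · refine ⟨μ, u, hu0, ?_, h2⟩
        convert hu using 1
        linear_combination (norm := module) -hp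
      · refine ⟨μ, v, hv0, ?_, h2⟩
        convert hv using 1
        linear_combination (norm := module) -hq
    · refine ⟨a + d - μ, _, hq, ?_, h1⟩
      convert hu.linearCombination hv c (d - μ) using 1
      linear_combination (norm := module) h2 • v
  · refine ⟨a + d - μ, _, hp, ?_, h1⟩
    convert hu.linearCombination hv (a - μ) b using 1
    linear_combination (norm := module) h2 • u

end TuringSystem

/-! ### Signs of the roots of a real quadratic -/

open TuringSystem

/-- The imaginary part forces `β` real or `β.re = t / 2`. A real `β ≥ 0` would make the left side
positive. -/
theorem re_neg_of_quadratic {t d : ℝ} {β : ℂ} (ht : t < 0) (hd : 0 < d)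
    (h : β ^ 2 - t * β + d = 0) : β.re < 0 := by
  have hre := congrArg Complex.re h
  have him := congrArg Complex.im h
  simp [pow_two] at hre him
  by_contra! hx
  have : β.im * (2 * β.re - t) = 0 := by linear_combination him
  rcases mul_eq_zero.1 this with hy | hy
  · rw [hy] at hre
    nlinarith
  · linarith

theorem re_nonpos_of_quadratic {t d : ℝ} {β : ℂ} (ht : t < 0) (hd : 0 ≤ d)
    (h : β ^ 2 - t * β + d = 0) : β.re ≤ 0 := by
  have hre := congrArg Complex.re h
  have him := congrArg Complex.im h
  simp [pow_two] at hre him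
  by_contra! hx
  have : β.im * (2 * β.re - t) = 0 := by linear_combination him
  rcases mul_eq_zero.1 this with hy | hy
  · rw [hy] at hre
    nlinarith
  · linarith

theorem exists_pos_root_of_quadratic {t d : ℝ} (hd : d < 0) :
    ∃ β : ℝ, 0 < β ∧ β ^ 2 - t * β + d = 0 := by
  have hs := Real.sq_sqrt (show 0 ≤ t ^ 2 - 4 * d by nlinarith [sq_nonneg t])
  have hlt : -t < √(t ^ 2 - 4 * d) := (neg_le_abs t).trans_lt (Real.lt_sqrt (abs_nonneg t) |>.2 (by rw [sq_abs]; linarith))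
  exact ⟨(t + √(t ^ 2 - 4 * d)) / 2, by linarith, by linear_combination hs / 4⟩

/-! ### Reduction to single modes -/

namespace ReactionDiffusionSystem

variable {n : ℕ} (S : ReactionDiffusionSystem n)

/-- The trace of the linearization on the eigenspace of `-Δ` with eigenvalue `l`. -/
noncomputable def modeTrace (l : ℝ) : ℝ := S.A.trace - l * (S.Du + S.Dv)

/-- The determinant of the linearization on the eigenspace of `-Δ` with eigenvalue `l`. -/
noncomputable def modeDet (l : ℝ) : ℝ :=
  (S.A 0 0 - l * S.Du) * (S.A 1 1 - l * S.Dv) - S.A 0 1 * S.A 1 0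

variable {S}

theorem IsEigenvalue.exists_mode {β : ℂ} (h : S.IsEigenvalue β) :
    ∃ l : ℝ, 0 ≤ l ∧ IsEigenvalueNegLaplacian S.Ω S.bc l ∧
      β ^ 2 - S.modeTrace l * β + S.modeDet l = 0 := by
  obtain ⟨u, v, Δu, Δv, huv, hu, hv, h1, h2⟩ := h
  have hDu : (S.Du : ℂ) ≠ 0 := by exact_mod_cast S.Du_pos.ne'
  have hDv : (S.Dv : ℂ) ≠ 0 := by exact_mod_cast S.Dv_pos.ne'
  have e1 : Δu = ((β - S.A 0 0) / S.Du) • u + (-S.A 0 1 / S.Du : ℂ) • v := by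
    apply smul_right_injective _ hDu
    simp only [smul_add, smul_smul, mul_div_cancel₀ _ hDu]
    linear_combination (norm := module) h1
  have e2 : Δv = (-S.A 1 0 / S.Dv : ℂ) • u + ((β - S.A 1 1) / S.Dv) • v := by
    apply smul_right_injective _ hDv
    simp only [smul_add, smul_smul, mul_div_cancel₀ _ hDv]
    linear_combination (norm := module) h2
  obtain ⟨μ, w, hw, hΔ, hdet⟩ := HasLaplacian.exists_eigenvector huv (e1 ▸ hu) (e2 ▸ hv)
  obtain ⟨l, hl, rfl, hl'⟩ := hΔ.exists_eigenvalue hw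
  refine ⟨l, hl, hl', ?_⟩
  -- With `μ = -l`, clearing `D_u D_v` leaves the characteristic equation of `A - l diag(D_u, D_v)`
  -- at `β`.
  field_simp at hdet
  simp only [modeTrace, modeDet, Matrix.trace_fin_two]
  push_cast
  linear_combination hdet

/-- A kernel vector `c` of `A - l diag(D_u, D_v) - β` gives the eigenvector `(c₀ w, c₁ w)`. -/
theorem isEigenvalue_of_mode {l β : ℝ} (hl : IsEigenvalueNegLaplacian S.Ω S.bc l)
    (hβ : β ^ 2 - S.modeTrace l * β + S.modeDet l = 0) : S.IsEigenvalue β := by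
  obtain ⟨w, Δw, hw, hΔ, he⟩ := hl
  let M : Matrix (Fin 2) (Fin 2) ℝ :=
    !![S.A 0 0 - l * S.Du - β, S.A 0 1; S.A 1 0, S.A 1 1 - l * S.Dv - β]
  have hM : M.det = 0 := by
    simp only [modeTrace, modeDet, Matrix.trace_fin_two] at hβ
    simp only [M, Matrix.det_fin_two_of]
    linear_combination hβ
  obtain ⟨c, hc, hMc⟩ := Matrix.exists_mulVec_eq_zero_iff.2 hM
  have h0 := congrFun hMc 0
  have h1 := congrFun hMc 1
  simp [M, Matrix.mulVec, dotProduct, Fin.sum_univ_two] at h0 h1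
  have h0' : ((S.A 0 0 : ℂ) - l * S.Du - β) * c 0 + S.A 0 1 * c 1 = 0 := by exact_mod_cast h0
  have h1' : (S.A 1 0 : ℂ) * c 0 + (S.A 1 1 - l * S.Dv - β) * c 1 = 0 := by exact_mod_cast h1
  refine ⟨(c 0 : ℂ) • w, (c 1 : ℂ) • w, (c 0 : ℂ) • Δw, (c 1 : ℂ) • Δw, ?_, hΔ.smul _, hΔ.smul _,
    ?_, ?_⟩
  · contrapose! hc
    simp only [smul_eq_zero, hw, or_false, Complex.ofReal_eq_zero] at hc
    ext i
    fin_cases i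
    exacts [hc.1, hc.2]
  · linear_combination (norm := module) h0' • w - ((S.Du : ℂ) * c 0) • he
  · linear_combination (norm := module) h1' • w - ((S.Dv : ℂ) * c 1) • he

theorem kineticallyStable (hdet : 0 < S.A.det) (htr : S.A.trace < 0) : S.KineticallyStable := by
  intro z hz
  obtain ⟨x, hx⟩ := hz.exists_hasEigenvector
  have hdet0 : (S.A.map Complex.ofReal - z • 1).det = 0 := by
    refine Matrix.exists_mulVec_eq_zero_iff.1 ⟨x, hx.2, ?_⟩
    have := hx.apply_eq_smul
    rw [Matrix.toLin'_apply] at this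
    rw [Matrix.sub_mulVec, this, Matrix.smul_mulVec, Matrix.one_mulVec, sub_self]
  refine re_neg_of_quadratic htr hdet ?_
  simp [Matrix.det_fin_two] at hdet0
  simp only [Matrix.trace_fin_two, Matrix.det_fin_two]
  push_cast
  linear_combination hdet0

theorem modeTrace_neg (htr : S.A.trace < 0) {l : ℝ} (hl : 0 ≤ l) : S.modeTrace l < 0 := by
  have := mul_nonneg hl (add_pos S.Du_pos S.Dv_pos).le
  unfold modeTrace
  linarith

theorem modeDet_eq (l : ℝ) :
    S.modeDet l = S.Du * S.Dv * l ^ 2 - (S.Dv * S.A 0 0 + S.Du * S.A 1 1) * l + S.A.det := by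
  rw [modeDet, Matrix.det_fin_two]
  ring

/-- Complete the square. For `L ≤ 0` the convention `√L = 0` makes both sides false. -/
theorem modeDet_neg_iff {D L : ℝ} (hD : D = S.Dv * S.A 0 0 + S.Du * S.A 1 1)
    (hL : L = -S.A.det / (S.Du * S.Dv) + D ^ 2 / (4 * S.Du ^ 2 * S.Dv ^ 2)) (l : ℝ) :
    S.modeDet l < 0 ↔ |l - D / (2 * S.Du * S.Dv)| < √L := by
  have hDu := S.Du_pos
  have hDv := S.Dv_pos
  have key : S.modeDet l = S.Du * S.Dv * ((l - D / (2 * S.Du * S.Dv)) ^ 2 - L) := by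
    rw [modeDet_eq, ← hD, hL]
    field_simp
    ring
  rw [key, Real.lt_sqrt (abs_nonneg _), sq_abs, ← sub_neg (b := L)]
  exact ⟨fun h => (pos_iff_neg_of_mul_neg h).1 (mul_pos hDu hDv),
    mul_neg_of_pos_of_neg (mul_pos hDu hDv)⟩

end ReactionDiffusionSystem

theorem theorem4p1 {n : ℕ} (S : ReactionDiffusionSystem n)
    (hdet : 0 < S.A.det) (htr : S.A.trace < 0) (D L : ℝ)
    (hD : D = S.Dv * S.A 0 0 + S.Du * S.A 1 1)
    (hL : L = -S.A.det / (S.Du * S.Dv) + D ^ 2 / (4 * S.Du ^ 2 * S.Dv ^ 2)) :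
    (D ≤ 0 → L ≤ 0 → S.TuringStable) ∧
    (0 < L → (S.TuringUnstable ↔
      ∃ l : ℝ, TuringSystem.IsEigenvalueNegLaplacian S.Ω S.bc l ∧
        |l - D / (2 * S.Du * S.Dv)| < √L)) := by
  refine ⟨fun hD0 _ β hβ => ?_, fun _ => ⟨?_, ?_⟩⟩
  · obtain ⟨l, hl, -, hq⟩ := hβ.exists_mode
    refine re_neg_of_quadratic (ReactionDiffusionSystem.modeTrace_neg htr hl) ?_ hq
    rw [ReactionDiffusionSystem.modeDet_eq, ← hD]
    have h1 : 0 ≤ S.Du * S.Dv * l ^ 2 :=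
      mul_nonneg (mul_pos S.Du_pos S.Dv_pos).le (sq_nonneg l)
    have h2 := mul_nonpos_of_nonpos_of_nonneg hD0 hl
    linarith
  · rintro ⟨-, β, hβ, hre⟩
    obtain ⟨l, hl, hl', hq⟩ := hβ.exists_mode
    refine ⟨l, hl', (ReactionDiffusionSystem.modeDet_neg_iff hD hL l).1 ?_⟩
    by_contra! hd
    exact hre.not_ge
      (re_nonpos_of_quadratic (ReactionDiffusionSystem.modeTrace_neg htr hl) hd hq)
  · rintro ⟨l, hl, hlt⟩
    obtain ⟨β, hβ, hq⟩ := exists_pos_root_of_quadratic (t := S.modeTrace l)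
      ((ReactionDiffusionSystem.modeDet_neg_iff hD hL l).2 hlt)
    exact ⟨ReactionDiffusionSystem.kineticallyStable hdet htr, β,
      ReactionDiffusionSystem.isEigenvalue_of_mode hl hq, by simpa using hβ⟩
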